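/- Let $N$ be a finite set with $|N|\ge 2$. Let $\Upsilon$ be the set of pairs $(a|B)$ with $a\in N$ and $\emptyset\ne B\subseteq N\setminus\{a\}$. For an acyclic directed graph $G$ over $N$ let $\mathrm{pa}_G(a)=\{b\in N: b\to a \text{ in } G\}$, and let $\eta_G\in\{0,1\}^{\Upsilon}$ be given by $\eta_G(a|B)=1$ if and only if $B=\mathrm{pa}_G(a)$. The family-variable polytope $\mathsf{F}\subseteq\mathbb{R}^{\Upsilon}$ is the convex hull of all vectors $\eta_G$, where $G$ runs over the acyclic directed graphs over $N$. A full graph over $N$ is an acyclic directed graph over $N$ in which every two distinct nodes are adjacent. An inequality $\langle o,\eta\rangle\le u$ is facet-defining for $\mathsf{F}$ if it holds for all $\eta\in\mathsf{F}$ and the face $\{\eta\in\mathsf{F}:\langle o,\eta\rangle=u\}$ has dimension $\dim(\mathsf{F})-1$. A function $m$ from the subsets of $N$ to $\mathbb{R}$ is standardized if $m(S)=0$ whenever $|S|\le 1$, and supermodular if $m(U)+m(V)\le m(U\cup V)+m(U\cap V)$ for all $U,V\subseteq N$; a standardized supermodular function is extreme if it is non-zero and generates an extreme ray of the cone of standardized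 supermodular functions. Theorem. Let $o\in\mathbb{R}^{\Upsilon}$ and $u\in\mathbb{R}$. The inequality $\langle o,\eta\rangle\le u$ is facet-defining for $\mathsf{F}$ and tight at all full graphs (that is, $\langle o,\eta_H\rangle=u$ for every full graph $H$ over $N$) if and only if there exists an extreme standardized supermodular function $m$ such that $$o(a|B)=m(\{a\}\cup B)-m(B)\qquad\text{for all }(a|B)\in\Upsilon,$$ and $u$ is the common value of $\langle o,\eta_H\rangle$ over all full graphs $H$ over $N$. -/

import Mathlib

namespace FamilyPolytope

open scoped Matrix

/-- An acyclic directed graph over the node set `N`; `Adj a b` is the arrow `a → b`. -/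
structure DAG (N : Type*) extends Digraph N where
  acyclic : ∀ a, ¬ Relation.TransGen Adj a a

/-- A full graph: every two distinct nodes are adjacent. -/
def DAG.IsFull {N : Type*} (G : DAG N) : Prop :=
  ∀ a b : N, a ≠ b → G.Adj a b ∨ G.Adj b a

open Classical in
/-- The parent set of the node `a` in `G`. -/
noncomputable def DAG.pa {N : Type*} [Fintype N] (G : DAG N) (a : N) : Finset N :=
  {b | G.Adj b a}

/-- The index set of family-variable vectors: pairs `(a | B)` with `a ∈ N` and
`∅ ≠ B ⊆ N \ {a}`. -/
abbrev Family (N : Type*) : Type _ :=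
  {p : N × Finset N // p.2.Nonempty ∧ p.1 ∉ p.2}

/-- The family-variable vector encoding `G`. -/
noncomputable def famVec {N : Type*} [Fintype N] [DecidableEq N] (G : DAG N) :
    Family N → ℝ :=
  fun p => if p.1.2 = G.pa p.1.1 then 1 else 0

/-- The family-variable polytope: the convex hull of all DAG-codes over `N`. -/
def FVP (N : Type*) [Fintype N] [DecidableEq N] : Set (Family N → ℝ) :=
  convexHull ℝ (Set.range (famVec (N := N)))

open Classical in
/-- The dimension of a set of vectors: the dimension of its affine hull
(`-1` for the empty set). -/
noncomputable def dim {Γ : Type*} (P : Set (Γ → ℝ)) : ℤ :=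
  if P = ∅ then -1 else (Module.finrank ℝ (affineSpan ℝ P).direction : ℤ)

/-- The inequality `⟨o, v⟩ ≤ u` is valid for all `v ∈ P`. -/
def IsValid {Γ : Type*} [Fintype Γ] (P : Set (Γ → ℝ)) (o : Γ → ℝ) (u : ℝ) : Prop :=
  ∀ v ∈ P, o ⬝ᵥ v ≤ u

/-- The subset of `P` on which the inequality `⟨o, v⟩ ≤ u` is tight; it is the face of `P`
defined by the inequality if the latter is valid. -/
def tightSet {Γ : Type*} [Fintype Γ] (P : Set (Γ → ℝ)) (o : Γ → ℝ) (u : ℝ) : Set (Γ → ℝ) :=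
  {v ∈ P | o ⬝ᵥ v = u}

/-- The inequality `⟨o, v⟩ ≤ u` is facet-defining for `P`: it is valid for `P` and the face
it defines has dimension `dim P - 1`. -/
def IsFacetDefining {Γ : Type*} [Fintype Γ] (P : Set (Γ → ℝ)) (o : Γ → ℝ) (u : ℝ) : Prop :=
  IsValid P o u ∧ dim (tightSet P o u) = dim P - 1

/-- A set function is standardized if it vanishes on sets with at most one element. -/
def IsStandardized {N : Type*} (m : Finset N → ℝ) : Prop :=
  ∀ S : Finset N, S.card ≤ 1 → m S = 0

/-- A set function is supermodular. -/
def IsSupermodular {N : Type*} [DecidableEq N] (m : Finset N → ℝ) : Prop :=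
  ∀ U V : Finset N, m U + m V ≤ m (U ∪ V) + m (U ∩ V)

/-- The standardized supermodular cone. -/
def supermodularCone (N : Type*) [DecidableEq N] : Set (Finset N → ℝ) :=
  {m | IsStandardized m ∧ IsSupermodular m}

/-- The ray generated by `m`. -/
def ray {N : Type*} (m : Finset N → ℝ) : Set (Finset N → ℝ) :=
  {x | ∃ c : ℝ, 0 ≤ c ∧ x = c • m}

/-- `m` is an extreme standardized supermodular function: it is a non-zero element of the
standardized supermodular cone that generates an extreme ray of this cone. -/
def IsExtremeSupermodular {N : Type*} [DecidableEq N] (m : Finset N → ℝ) : Prop :=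
  m ∈ supermodularCone N ∧ m ≠ 0 ∧ IsExtreme ℝ (supermodularCone N) (ray m)

/-- The objective `o` is determined by the set function `m`:
`o (a | B) = m ({a} ∪ B) - m B` for every family `(a | B)`. For `B = ∅` and standardized `m`
the right-hand side is `0`, in accordance with the convention `o (a | ∅) = 0`. -/
def IsDeterminedBy {N : Type*} [DecidableEq N] (o : Family N → ℝ) (m : Finset N → ℝ) : Prop :=
  ∀ p : Family N, o p = m (insert p.1.1 p.1.2) - m p.1.2

end FamilyPolytope

namespace FamilyPolytope

open Finset

/-! Valid inequalities tight at all full graphs form a copy of the standardized supermodular cone,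
and facets correspond to extreme rays. Peeling off sinks one at a time, an objective determined by
`m` telescopes to `m univ` at every full graph, and supermodularity makes `m univ` an upper bound at
all other graphs (`sum_objExt_eq_of_isFull`, `sum_objExt_le`). Conversely, tightness at full graphs
makes sums of family terms independent of the node order, so they define `m`; validity after
deleting parents of one node makes the increments of `m` monotone (`exists_isDeterminedBy`). The
polytope is full-dimensional, so the face of a facet spans the hyperplane of `o`, and any
decomposition of `m` in the cone is tight on that face, hence proportional to `m`. If the face spans
less, a functional constant on it perturbs `o` in both directions inside the cone, which extremality
of `m` forbids. -/

/-! ### Graphs, rankings and objective values -/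

/-- The extension of an objective to all pairs `(a | B)`, by zero outside of `Family N`. -/
noncomputable def objExt {N : Type*} [DecidableEq N] (o : Family N → ℝ) (a : N)
    (B : Finset N) : ℝ :=
  if h : B.Nonempty ∧ a ∉ B then o ⟨(a, B), h⟩ else 0

theorem objExt_apply {N : Type*} [DecidableEq N] (o : Family N → ℝ) (p : Family N) :
    objExt o p.1.1 p.1.2 = o p := dif_pos p.2

@[simp] theorem objExt_empty {N : Type*} [DecidableEq N] (o : Family N → ℝ) (a : N) :
    objExt o a ∅ = 0 := by
  simp [objExt]

@[simp] theorem DAG.mem_pa {N : Type*} [Fintype N] (G : DAG N) (a b : N) :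
    b ∈ G.pa a ↔ G.Adj b a := by
  simp [DAG.pa]

theorem DAG.notMem_pa_self {N : Type*} [Fintype N] (G : DAG N) (a : N) : a ∉ G.pa a := by
  rw [DAG.mem_pa]
  exact fun h => G.acyclic a (.single h)

/-- The objective value at a DAG-code is the sum of the terms of its families. -/
theorem dotProduct_famVec {N : Type*} [Fintype N] [DecidableEq N] (o : Family N → ℝ)
    (G : DAG N) : o ⬝ᵥ famVec G = ∑ a, objExt o a (G.pa a) := by
  have h1 : o ⬝ᵥ famVec G = ∑ p : Family N, objExt o p.1.1 p.1.2 *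
      (if p.1.2 = G.pa p.1.1 then 1 else 0) :=
    Finset.sum_congr rfl fun p _ => by rw [objExt_apply]; rfl
  have h2 := Finset.sum_subtype (F := inferInstance) (p := fun q : N × Finset N =>
      q.2.Nonempty ∧ q.1 ∉ q.2) {q | q.2.Nonempty ∧ q.1 ∉ q.2} (by simp)
    fun q : N × Finset N => objExt o q.1 q.2 * (if q.2 = G.pa q.1 then 1 else 0)
  rw [h1, ← h2, Finset.sum_filter, Fintype.sum_prod_type]
  refine Finset.sum_congr rfl fun a _ => ?_
  rw [Finset.sum_eq_single (G.pa a)]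
  · by_cases h : (G.pa a).Nonempty <;> simp [h, G.notMem_pa_self, objExt]
  · intro B _ hB
    simp [hB]
  · simp

/-- The acyclic directed graph with prescribed parent sets compatible with a ranking. -/
def DAG.ofParents {N : Type*} (P : N → Finset N) (r : N → ℕ)
    (h : ∀ a, ∀ b ∈ P a, r b < r a) : DAG N where
  Adj b a := b ∈ P a
  acyclic a ha := by
    have key : ∀ x y, Relation.TransGen (fun b a => b ∈ P a) x y → r x < r y := by
      intro x y hxy
      induction hxy with
      | single h' => exact h _ _ h'
      | tail _ h' ih => exact ih.trans (h _ _ h')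
    exact lt_irrefl _ (key a a ha)

@[simp] theorem DAG.pa_ofParents {N : Type*} [Fintype N] (P : N → Finset N) (r : N → ℕ)
    (h : ∀ a, ∀ b ∈ P a, r b < r a) (a : N) : (DAG.ofParents P r h).pa a = P a := by
  ext b
  rw [DAG.mem_pa]
  rfl

/-- The full graph in which arrows go from lower to higher rank. -/
def DAG.ofRank {N : Type*} [Fintype N] (r : N → ℕ) : DAG N :=
  DAG.ofParents (fun a => {b | r b < r a}) r (by simp)

theorem DAG.isFull_ofRank {N : Type*} [Fintype N] {r : N → ℕ} (hr : Function.Injective r) :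
    (DAG.ofRank r).IsFull := by
  intro a b hab
  have := hr.ne hab
  rw [← DAG.mem_pa, ← DAG.mem_pa]
  simp only [DAG.ofRank, DAG.pa_ofParents, Finset.mem_filter_univ]
  omega

theorem DAG.exists_isFull (N : Type*) [Fintype N] : ∃ H : DAG N, H.IsFull :=
  ⟨DAG.ofRank fun a => Fintype.equivFin N a,
    DAG.isFull_ofRank (Fin.val_injective.comp (Fintype.equivFin N).injective)⟩

/-- Every nonempty set of nodes of an acyclic directed graph contains a sink. -/
theorem DAG.exists_sink {N : Type*} [Fintype N] (G : DAG N) {S : Finset N} (hS : S.Nonempty) :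
    ∃ a ∈ S, ∀ b ∈ S, ¬ G.Adj a b := by
  have : IsTrans N (Function.swap (Relation.TransGen G.Adj)) :=
    ⟨fun _ _ _ h1 h2 => h2.trans h1⟩
  have : Std.Irrefl (Function.swap (Relation.TransGen G.Adj)) := ⟨G.acyclic⟩
  have wf : WellFounded (Function.swap (Relation.TransGen G.Adj)) :=
    Finite.wellFounded_of_trans_of_irrefl _
  obtain ⟨a, ha, h⟩ := wf.has_min (S : Set N) hS
  exact ⟨a, ha, fun b hb hab => h b hb (.single hab)⟩

/-! ### From supermodular functions to valid inequalities -/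

theorem IsStandardized.objExt_eq {N : Type*} [DecidableEq N] {o : Family N → ℝ}
    {m : Finset N → ℝ} (hm : IsStandardized m) (ho : IsDeterminedBy o m) {a : N}
    {B : Finset N} (ha : a ∉ B) : objExt o a B = m (insert a B) - m B := by
  rcases B.eq_empty_or_nonempty with rfl | hB
  · rw [objExt_empty, hm _ (by simp), hm _ (by simp), sub_zero]
  · exact (dif_pos ⟨hB, ha⟩).trans (ho ⟨(a, B), hB, ha⟩)

theorem IsSupermodular.insert_sub_le {N : Type*} [DecidableEq N] {m : Finset N → ℝ}
    (hm : IsSupermodular m) {a : N} {C B : Finset N} (hCB : C ⊆ B) (ha : a ∉ B) :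
    m (insert a C) - m C ≤ m (insert a B) - m B := by
  have h := hm (insert a C) B
  rw [Finset.insert_union, Finset.union_eq_right.2 hCB, Finset.insert_inter_of_notMem ha,
    Finset.inter_eq_left.2 hCB] at h
  linarith

/-- Removing a sink of `S` leaves a parent-closed set, and the term of that sink is at most the last
increment of `m`, since its parents lie in the remaining set. -/
theorem sum_objExt_le {N : Type*} [Fintype N] [DecidableEq N] {o : Family N → ℝ}
    {m : Finset N → ℝ} (hm : m ∈ supermodularCone N) (ho : IsDeterminedBy o m) (G : DAG N)
    (S : Finset N) (hS : ∀ a ∈ S, G.pa a ⊆ S) : ∑ a ∈ S, objExt o a (G.pa a) ≤ m S := by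
  induction hn : S.card generalizing S with
  | zero => simp [Finset.card_eq_zero.1 hn, hm.1 ∅ (by simp)]
  | succ n ih =>
    obtain ⟨a, ha, hsink⟩ := G.exists_sink (S := S) (Finset.card_pos.1 (by omega))
    have hpa : ∀ b ∈ S, G.pa b ⊆ S.erase a := fun b hb c hc =>
      Finset.mem_erase.2 ⟨by rintro rfl; exact hsink b hb ((G.mem_pa _ _).1 hc), hS b hb hc⟩
    have h1 := ih (S.erase a) (fun b hb => hpa b (Finset.mem_of_mem_erase hb))
      (by rw [Finset.card_erase_of_mem ha, hn]; rfl)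
    have h2 := hm.2.insert_sub_le (hpa a ha) (Finset.notMem_erase a S)
    rw [Finset.insert_erase ha, ← hm.1.objExt_eq ho (G.notMem_pa_self a)] at h2
    rw [← Finset.add_sum_erase S _ ha]
    linarith

theorem sum_objExt_eq_of_isFull {N : Type*} [Fintype N] [DecidableEq N] {o : Family N → ℝ}
    {m : Finset N → ℝ} (hm : IsStandardized m) (ho : IsDeterminedBy o m) {G : DAG N}
    (hG : G.IsFull) (S : Finset N) (hS : ∀ a ∈ S, G.pa a ⊆ S) :
    ∑ a ∈ S, objExt o a (G.pa a) = m S := by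
  induction hn : S.card generalizing S with
  | zero => simp [Finset.card_eq_zero.1 hn, hm ∅ (by simp)]
  | succ n ih =>
    obtain ⟨a, ha, hsink⟩ := G.exists_sink (S := S) (Finset.card_pos.1 (by omega))
    have hpa : ∀ b ∈ S, G.pa b ⊆ S.erase a := fun b hb c hc =>
      Finset.mem_erase.2 ⟨by rintro rfl; exact hsink b hb ((G.mem_pa _ _).1 hc), hS b hb hc⟩
    have h1 := ih (S.erase a) (fun b hb => hpa b (Finset.mem_of_mem_erase hb))
      (by rw [Finset.card_erase_of_mem ha, hn]; rfl)
    -- In a full graph the parents of the sink are all of the remaining set, so the bound becomes an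
    -- equality.
    have h2 : G.pa a = S.erase a := (hpa a ha).antisymm fun b hb => by
      rw [Finset.mem_erase] at hb
      exact (G.mem_pa _ _).2 ((hG a b hb.1.symm).resolve_left (hsink b hb.2))
    rw [← Finset.add_sum_erase S _ ha, h1, h2, hm.objExt_eq ho (Finset.notMem_erase a S),
      Finset.insert_erase ha, sub_add_cancel]

theorem dotProduct_famVec_le {N : Type*} [Fintype N] [DecidableEq N] {o : Family N → ℝ}
    {m : Finset N → ℝ} (hm : m ∈ supermodularCone N) (ho : IsDeterminedBy o m) (G : DAG N) :
    o ⬝ᵥ famVec G ≤ m Finset.univ := by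
  rw [dotProduct_famVec]
  exact sum_objExt_le hm ho G _ fun _ _ => Finset.subset_univ _

theorem dotProduct_famVec_eq_of_isFull {N : Type*} [Fintype N] [DecidableEq N]
    {o : Family N → ℝ} {m : Finset N → ℝ} (hm : IsStandardized m) (ho : IsDeterminedBy o m)
    {G : DAG N} (hG : G.IsFull) : o ⬝ᵥ famVec G = m Finset.univ := by
  rw [dotProduct_famVec]
  exact sum_objExt_eq_of_isFull hm ho hG _ fun _ _ => Finset.subset_univ _

theorem isValid_FVP_iff {N : Type*} [Fintype N] [DecidableEq N] {o : Family N → ℝ} {u : ℝ} :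
    IsValid (FVP N) o u ↔ ∀ G : DAG N, o ⬝ᵥ famVec G ≤ u := by
  constructor
  · exact fun h G => h _ (subset_convexHull ℝ _ ⟨G, rfl⟩)
  · intro h v hv
    have hc : Convex ℝ {v : Family N → ℝ | o ⬝ᵥ v ≤ u} :=
      convex_halfSpace_le ⟨dotProduct_add o, fun c v => dotProduct_smul c o v⟩ u
    exact convexHull_min (by rintro _ ⟨G, rfl⟩; exact h G) hc hv

/-! ### From valid inequalities to supermodular functions -/

/-- The increments of the set function along a fixed ranking, in the presence of tightness at
full graphs, reproduce the objective. -/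
theorem sum_objExt_insert {N : Type*} [Fintype N] [DecidableEq N] {o : Family N → ℝ} {u : ℝ}
    (ht : ∀ H : DAG N, H.IsFull → o ⬝ᵥ famVec H = u) {e : N → ℕ} (he : Function.Injective e)
    {a : N} {B : Finset N} (ha : a ∉ B) :
    ∑ x ∈ insert a B, objExt o x {y ∈ insert a B | e y < e x} =
      ∑ x ∈ B, objExt o x {y ∈ B | e y < e x} + objExt o a B := by
  obtain ⟨M, hM⟩ : ∃ M, ∀ x, e x < M :=
    ⟨univ.sup e + 1, fun x => Nat.lt_succ_of_le (Finset.le_sup (Finset.mem_univ x))⟩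
  -- `r₁` lists `B`, then `a`, then the rest; `r₂` lists `insert a B` in the order of `e`, then the
  -- rest. The rest has the same parents in both, so those terms cancel.
  let r₁ : N → ℕ := fun x => if x ∈ B then e x else if x = a then M else M + 1 + e x
  let r₂ : N → ℕ := fun x => if x ∈ insert a B then e x else M + 1 + e x
  have h₁ : Function.Injective r₁ := by
    intro x y hxy
    have := hM x
    have := hM y
    simp only [r₁] at hxy
    split_ifs at hxy <;> first | omega | (apply he; omega) | simp_all
  have h₂ : Function.Injective r₂ := by
    intro x y hxy
    have := hM x
    have := hM y
    simp only [r₂] at hxy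
    split_ifs at hxy <;> first | omega | (apply he; omega)
  have e₁ := ht _ (DAG.isFull_ofRank h₁)
  have e₂ := ht _ (DAG.isFull_ofRank h₂)
  rw [dotProduct_famVec, ← Finset.sum_add_sum_compl (insert a B)] at e₁ e₂
  have hrest : ∑ x ∈ (insert a B)ᶜ, objExt o x ((DAG.ofRank r₁).pa x) =
      ∑ x ∈ (insert a B)ᶜ, objExt o x ((DAG.ofRank r₂).pa x) := by
    refine Finset.sum_congr rfl fun x hx => ?_
    congr 1
    ext y
    simp only [Finset.mem_compl, Finset.mem_insert, not_or] at hx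
    have := hM y
    simp only [DAG.ofRank, DAG.pa_ofParents, Finset.mem_filter_univ, r₁, r₂, hx.1, hx.2,
      Finset.mem_insert, or_self, if_false]
    by_cases hyB : y ∈ B <;> by_cases hya : y = a <;> simp [hyB, hya, ha]
    all_goals first | omega | (have := hM a; omega)
  have hins : ∑ x ∈ insert a B, objExt o x ((DAG.ofRank r₂).pa x) =
      ∑ x ∈ insert a B, objExt o x {y ∈ insert a B | e y < e x} := by
    refine Finset.sum_congr rfl fun x hx => ?_
    congr 1
    ext y
    have := hM x
    simp only [DAG.ofRank, DAG.pa_ofParents, Finset.mem_filter, r₂,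
      hx, if_true]
    split_ifs with hy
    · simp [hy]
    · simp only [hy, false_and, iff_false]
      omega
  have hB : ∑ x ∈ B, objExt o x ((DAG.ofRank r₁).pa x) =
      ∑ x ∈ B, objExt o x {y ∈ B | e y < e x} := by
    refine Finset.sum_congr rfl fun x hx => ?_
    congr 1
    ext y
    have := hM x
    simp only [DAG.ofRank, DAG.pa_ofParents, Finset.mem_filter, r₁,
      hx, if_true]
    split_ifs with hy hy'
    · simp [hy]
    all_goals
      simp only [hy, false_and, iff_false]
      omega
  have hpa : (DAG.ofRank r₁).pa a = B := by
    ext y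
    have := hM y
    simp only [DAG.ofRank, DAG.pa_ofParents, Finset.mem_filter_univ, r₁, ha, if_false, if_true]
    split_ifs with hy hy'
    · simp [hy, this]
    all_goals
      simp only [hy, iff_false]
      omega
  rw [Finset.sum_insert ha, hB, hpa, hrest] at e₁
  rw [hins] at e₂
  linarith

/-- An objective of a valid inequality that is tight at all full graphs is monotone with respect
to the parent set. -/
theorem objExt_mono {N : Type*} [Fintype N] [DecidableEq N] {o : Family N → ℝ} {u : ℝ}
    (hv : ∀ G : DAG N, o ⬝ᵥ famVec G ≤ u)
    (ht : ∀ H : DAG N, H.IsFull → o ⬝ᵥ famVec H = u) {a : N} {C B : Finset N} (hCB : C ⊆ B)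
    (ha : a ∉ B) : objExt o a C ≤ objExt o a B := by
  obtain ⟨e, he, hB⟩ : ∃ e : N → ℕ, Function.Injective e ∧ ∀ y, e y < e a ↔ y ∈ B := by
    let e : N → ℕ := fun x => Fintype.equivFin N x
    have he : Function.Injective e := Fin.val_injective.comp (Fintype.equivFin N).injective
    have hM : ∀ x, e x < Fintype.card N := fun x => (Fintype.equivFin N x).2
    refine ⟨fun x => if x ∈ B then e x else if x = a then Fintype.card N
      else Fintype.card N + 1 + e x, ?_, ?_⟩
    · intro x y hxy
      have := hM x
      have := hM y
      dsimp only at hxy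
      split_ifs at hxy <;> first | omega | (apply he; omega) | simp_all
    · intro y
      have := hM y
      simp only [ha, if_false, if_true]
      split_ifs with hy hy'
      · simp [hy, this]
      all_goals
        simp only [hy, iff_false]
        omega
  have hpaB : (DAG.ofRank e).pa a = B := by
    ext y
    simp [DAG.ofRank, hB]
  -- Shrinking the parents of `a` from `B` to `C` in a full graph changes a single term and cannot
  -- raise the value above `u`.
  let G : DAG N := DAG.ofParents (Function.update (fun x => ({y | e y < e x} : Finset N)) a C) e (by
    intro x y hy
    rcases eq_or_ne x a with rfl | hx
    · rw [Function.update_self] at hy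
      exact (hB y).2 (hCB hy)
    · simpa [Function.update_of_ne hx] using hy)
  have h1 := ht _ (DAG.isFull_ofRank he)
  have h2 := hv G
  rw [dotProduct_famVec, ← Finset.add_sum_erase _ _ (Finset.mem_univ a)] at h1 h2
  have h3 : ∑ x ∈ univ.erase a, objExt o x (G.pa x) =
      ∑ x ∈ univ.erase a, objExt o x ((DAG.ofRank e).pa x) := by
    refine Finset.sum_congr rfl fun x hx => ?_
    simp only [G, DAG.ofRank, DAG.pa_ofParents, Function.update_of_ne (Finset.ne_of_mem_erase hx)]
  have h4 : G.pa a = C := by simp [G]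
  rw [h3, h4] at h2
  rw [hpaB] at h1
  linarith

/-- Monotonicity of one-element increments sums to monotonicity for adding a set `T`; take `T = V \
U` over `U ∩ V ⊆ U`. -/
theorem isSupermodular_of_insert_sub_le {N : Type*} [DecidableEq N] {m : Finset N → ℝ}
    (h : ∀ (a : N) (C B : Finset N), C ⊆ B → a ∉ B →
      m (insert a C) - m C ≤ m (insert a B) - m B) : IsSupermodular m := by
  have key : ∀ (T C B : Finset N), C ⊆ B → Disjoint T B →
      m (T ∪ C) - m C ≤ m (T ∪ B) - m B := by
    intro T
    induction T using Finset.induction_on with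
    | empty => intro C B _ _; simp
    | insert a T ha ih =>
      intro C B hCB hd
      rw [Finset.disjoint_insert_left] at hd
      have h1 := ih C B hCB hd.2
      have h2 := h a (T ∪ C) (T ∪ B) (Finset.union_subset_union_right hCB)
        (by simp [ha, hd.1])
      rw [Finset.insert_union, Finset.insert_union]
      linarith
  intro U V
  have h1 := key (V \ U) (U ∩ V) U Finset.inter_subset_left Finset.sdiff_disjoint
  rw [Finset.sdiff_union_self_eq_union, Finset.inter_comm, Finset.sdiff_union_inter,
    Finset.union_comm V U, Finset.inter_comm] at h1
  linarith

/-- The objective of a valid inequality that is tight at all full graphs is determined by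
a standardized supermodular function. -/
theorem exists_isDeterminedBy {N : Type*} [Fintype N] [DecidableEq N] {o : Family N → ℝ} {u : ℝ}
    (hv : ∀ G : DAG N, o ⬝ᵥ famVec G ≤ u)
    (ht : ∀ H : DAG N, H.IsFull → o ⬝ᵥ famVec H = u) :
    ∃ m ∈ supermodularCone N, IsDeterminedBy o m := by
  let e : N → ℕ := fun x => Fintype.equivFin N x
  have he : Function.Injective e := Fin.val_injective.comp (Fintype.equivFin N).injective
  let m : Finset N → ℝ := fun S => ∑ x ∈ S, objExt o x {y ∈ S | e y < e x}
  have hm : ∀ (a : N) (B : Finset N), a ∉ B → m (insert a B) - m B = objExt o a B :=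
    fun a B ha => by simp only [m, sum_objExt_insert ht he ha]; ring
  refine ⟨m, ⟨fun S hS => ?_, isSupermodular_of_insert_sub_le fun a C B hCB ha => ?_⟩,
    fun p => ?_⟩
  · rcases S.eq_empty_or_nonempty with rfl | hne
    · simp [m]
    · obtain ⟨a, rfl⟩ := Finset.card_eq_one.1 (le_antisymm hS hne.card_pos)
      simp [m, Finset.filter_singleton]
  · rw [hm a C fun h => ha (hCB h), hm a B ha]
    exact objExt_mono hv ht hCB ha
  · rw [hm _ _ p.2.2, objExt_apply]

/-! ### Linearity and uniqueness of the correspondence -/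

/-- A standardized set function is determined by the objective it induces. -/
theorem IsStandardized.ext_of_isDeterminedBy {N : Type*} [DecidableEq N] {o : Family N → ℝ}
    {m m' : Finset N → ℝ} (hm : IsStandardized m) (hm' : IsStandardized m')
    (ho : IsDeterminedBy o m) (ho' : IsDeterminedBy o m') : m = m' := by
  funext S
  induction S using Finset.induction_on with
  | empty => rw [hm _ (by simp), hm' _ (by simp)]
  | insert a S ha ih =>
    have h1 := hm.objExt_eq ho ha
    have h2 := hm'.objExt_eq ho' ha
    linarith

theorem nonneg_of_mem_supermodularCone {N : Type*} [DecidableEq N] {m : Finset N → ℝ}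
    (hm : m ∈ supermodularCone N) (S : Finset N) : 0 ≤ m S := by
  induction S using Finset.induction_on with
  | empty => rw [hm.1 _ (by simp)]
  | insert a S ha ih =>
    have h := hm.2.insert_sub_le (Finset.empty_subset S) ha
    rw [hm.1 (insert a ∅) (by simp), hm.1 ∅ (by simp)] at h
    linarith

theorem IsDeterminedBy.smul {N : Type*} [DecidableEq N] {o : Family N → ℝ} {m : Finset N → ℝ}
    (h : IsDeterminedBy o m) (c : ℝ) : IsDeterminedBy (c • o) (c • m) := fun p => by
  simp only [Pi.smul_apply, smul_eq_mul, h p, mul_sub]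

theorem IsDeterminedBy.add {N : Type*} [DecidableEq N] {o o' : Family N → ℝ}
    {m m' : Finset N → ℝ} (h : IsDeterminedBy o m) (h' : IsDeterminedBy o' m') :
    IsDeterminedBy (o + o') (m + m') := fun p => by
  simp only [Pi.add_apply, h p, h' p]
  ring

theorem IsDeterminedBy.unique {N : Type*} [DecidableEq N] {o o' : Family N → ℝ}
    {m : Finset N → ℝ} (h : IsDeterminedBy o m) (h' : IsDeterminedBy o' m) : o = o' :=
  funext fun p => (h p).trans (h' p).symm

theorem IsStandardized.smul {N : Type*} {m : Finset N → ℝ} (h : IsStandardized m) (c : ℝ) :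
    IsStandardized (c • m) := fun S hS => by
  simp [h S hS]

theorem IsStandardized.add {N : Type*} {m m' : Finset N → ℝ} (h : IsStandardized m)
    (h' : IsStandardized m') : IsStandardized (m + m') := fun S hS => by
  simp [h S hS, h' S hS]

/-! ### Dimension of the polytope and its faces -/

/-- The graph whose only nonempty parent set is that of `p` differs from the empty graph by the
basis vector at `p`. -/
theorem vectorSpan_FVP (N : Type*) [Fintype N] [DecidableEq N] : vectorSpan ℝ (FVP N) = ⊤ := by
  have hmem : ∀ G : DAG N, famVec G ∈ FVP N := fun G => subset_convexHull ℝ _ ⟨G, rfl⟩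
  rw [eq_top_iff, ← (Pi.basisFun ℝ (Family N)).span_eq, Submodule.span_le]
  rintro _ ⟨p, rfl⟩
  let G : DAG N := DAG.ofParents (Function.update (fun _ => ∅) p.1.1 p.1.2)
    (fun x => if x = p.1.1 then 1 else 0) (by
      intro a b hb
      rcases eq_or_ne a p.1.1 with rfl | ha
      · rw [Function.update_self] at hb
        have : b ≠ p.1.1 := by rintro rfl; exact p.2.2 hb
        simp [this]
      · simp [Function.update_of_ne ha] at hb)
  let G₀ : DAG N := DAG.ofParents (fun _ => ∅) (fun _ => 0) (by simp)
  have h : Pi.basisFun ℝ (Family N) p = famVec G - famVec G₀ := by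
    rw [Pi.basisFun_apply]
    funext q
    have hq := q.2.1.ne_empty
    simp only [Pi.sub_apply, famVec, G, G₀, DAG.pa_ofParents, hq, if_false, sub_zero,
      Pi.single_apply]
    refine if_congr ?_ rfl rfl
    constructor
    · rintro rfl
      simp
    · intro h
      rcases eq_or_ne q.1.1 p.1.1 with h' | h'
      · rw [h', Function.update_self] at h
        exact Subtype.ext (Prod.ext h' h)
      · rw [Function.update_of_ne h'] at h
        exact absurd h hq
  rw [h]
  exact vsub_mem_vectorSpan ℝ (hmem _) (hmem _)

theorem dim_of_nonempty {Γ : Type*} {P : Set (Γ → ℝ)} (h : P.Nonempty) :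
    dim P = Module.finrank ℝ (vectorSpan ℝ P) := by
  rw [dim, if_neg h.ne_empty, direction_affineSpan]

theorem dim_FVP (N : Type*) [Fintype N] [DecidableEq N] :
    dim (FVP N) = Fintype.card (Family N) := by
  obtain ⟨H, -⟩ := DAG.exists_isFull N
  have hmem : famVec H ∈ FVP N := subset_convexHull ℝ _ ⟨H, rfl⟩
  rw [dim_of_nonempty ⟨_, hmem⟩, vectorSpan_FVP, finrank_top,
    Module.finrank_fintype_fun_eq_card]

/-- The linear functional `v ↦ ⟨o, v⟩`. -/
noncomputable def dotLin {Γ : Type*} [Fintype Γ] (o : Γ → ℝ) : Module.Dual ℝ (Γ → ℝ) :=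
  dotProductBilin ℝ ℝ o

@[simp] theorem dotLin_apply {Γ : Type*} [Fintype Γ] (o v : Γ → ℝ) : dotLin o v = o ⬝ᵥ v := rfl

theorem exists_dotLin_eq {Γ : Type*} [Fintype Γ] (f : Module.Dual ℝ (Γ → ℝ)) :
    ∃ o, dotLin o = f := by
  classical
  refine ⟨fun i => f (Pi.single i 1), (Pi.basisFun ℝ Γ).ext fun i => ?_⟩
  simp

theorem dotLin_ne_zero {Γ : Type*} [Fintype Γ] {o : Γ → ℝ} (ho : o ≠ 0) : dotLin o ≠ 0 :=
  fun h => ho (dotProduct_self_eq_zero.1 (by rw [← dotLin_apply, h]; rfl))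

theorem vectorSpan_le_ker {Γ : Type*} [Fintype Γ] {T : Set (Γ → ℝ)} {o : Γ → ℝ} {u : ℝ}
    (h : ∀ v ∈ T, o ⬝ᵥ v = u) : vectorSpan ℝ T ≤ LinearMap.ker (dotLin o) := by
  rw [vectorSpan_def, Submodule.span_le]
  rintro _ ⟨v, hv, w, hw, rfl⟩
  simp [dotProduct_sub, h v hv, h w hw]

theorem finrank_ker_dotLin {Γ : Type*} [Fintype Γ] {o : Γ → ℝ} (ho : o ≠ 0) :
    Module.finrank ℝ (LinearMap.ker (dotLin o)) + 1 = Fintype.card Γ := by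
  rw [Module.Dual.finrank_ker_add_one_of_ne_zero (dotLin_ne_zero ho),
    Module.finrank_fintype_fun_eq_card]

/-- A facet of the full-dimensional family-variable polytope spans the whole hyperplane. -/
theorem dim_tightSet_eq_iff {N : Type*} [Fintype N] [DecidableEq N] {o : Family N → ℝ} {u : ℝ}
    (ho : o ≠ 0) (hne : (tightSet (FVP N) o u).Nonempty) :
    dim (tightSet (FVP N) o u) = dim (FVP N) - 1 ↔
      vectorSpan ℝ (tightSet (FVP N) o u) = LinearMap.ker (dotLin o) := by
  have h := finrank_ker_dotLin ho
  rw [dim_of_nonempty hne, dim_FVP]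
  constructor
  · intro h'
    exact Submodule.eq_of_le_of_finrank_eq (vectorSpan_le_ker fun v hv => hv.2) (by omega)
  · intro h'
    rw [h']
    omega

theorem finite_range_famVec (N : Type*) [Fintype N] [DecidableEq N] :
    (Set.range (famVec (N := N))).Finite := by
  refine Set.Finite.subset (Set.Finite.pi' fun _ : Family N => Set.toFinite ({0, 1} : Set ℝ)) ?_
  rintro _ ⟨G, rfl⟩ p
  simp only [famVec]
  split_ifs <;> simp

/-! ### Facets versus extreme rays -/

/-- A functional constant on the tight vertices gives rise to small two-sided perturbations of
a valid inequality. -/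
theorem exists_perturbation {N : Type*} [Fintype N] [DecidableEq N] {o o' : Family N → ℝ}
    {u u' : ℝ} (hv : ∀ G : DAG N, o ⬝ᵥ famVec G ≤ u)
    (h : ∀ G : DAG N, o ⬝ᵥ famVec G = u → o' ⬝ᵥ famVec G = u') :
    ∃ ε > 0, ∀ G : DAG N, ε * |o' ⬝ᵥ famVec G - u'| ≤ u - o ⬝ᵥ famVec G := by
  have key : ∀ w ∈ Set.range (famVec (N := N)),
      ∀ᶠ ε : ℝ in nhdsWithin 0 (Set.Ioi 0), ε * |o' ⬝ᵥ w - u'| ≤ u - o ⬝ᵥ w := by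
    rintro _ ⟨G, rfl⟩
    rcases (hv G).eq_or_lt with hG | hG
    · simp [h G hG, hG]
    · have hc : Filter.Tendsto (fun ε : ℝ => ε * |o' ⬝ᵥ famVec G - u'|)
          (nhdsWithin 0 (Set.Ioi 0)) (nhds (0 * |o' ⬝ᵥ famVec G - u'|)) :=
        (Continuous.tendsto (by fun_prop) 0).mono_left nhdsWithin_le_nhds
      rw [zero_mul] at hc
      exact (hc.eventually_lt_const (sub_pos.2 hG)).mono fun _ => le_of_lt
  obtain ⟨ε, h1, h2⟩ := (((finite_range_famVec N).eventually_all.2 key).and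
    self_mem_nhdsWithin).exists
  exact ⟨ε, h2, fun G => h1 _ ⟨G, rfl⟩⟩

theorem zero_mem_ray {N : Type*} (m : Finset N → ℝ) : 0 ∈ ray m := ⟨0, le_rfl, by simp⟩

theorem smul_mem_supermodularCone {N : Type*} [DecidableEq N] {m : Finset N → ℝ}
    (hm : m ∈ supermodularCone N) {c : ℝ} (hc : 0 ≤ c) : c • m ∈ supermodularCone N :=
  ⟨hm.1.smul c, fun U V => by
    have := mul_le_mul_of_nonneg_left (hm.2 U V) hc
    simpa only [Pi.smul_apply, smul_eq_mul, mul_add] using this⟩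

/-- The set function determining a facet-defining inequality is extreme. -/
theorem isExtremeSupermodular_of_vectorSpan_eq_ker {N : Type*} [Fintype N] [DecidableEq N]
    {o : Family N → ℝ} {u : ℝ} {m : Finset N → ℝ} (ho : o ≠ 0)
    (hm : m ∈ supermodularCone N) (hom : IsDeterminedBy o m)
    (ht : ∀ H : DAG N, H.IsFull → o ⬝ᵥ famVec H = u)
    (hs : vectorSpan ℝ (tightSet (FVP N) o u) = LinearMap.ker (dotLin o)) :
    IsExtremeSupermodular m := by
  have hm0 : m ≠ 0 := by
    rintro rfl
    exact ho (funext fun p => by simp [hom p])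
  obtain ⟨H, hH⟩ := DAG.exists_isFull N
  have hu : m univ = u := by rw [← dotProduct_famVec_eq_of_isFull hm.1 hom hH, ht H hH]
  refine ⟨hm, hm0, ⟨?_, ?_⟩⟩
  · rintro _ ⟨c, hc, rfl⟩
    exact smul_mem_supermodularCone hm hc
  rintro x hx y hy _ ⟨c, hc, rfl⟩ ⟨α, β, hα, hβ, -, hz⟩
  rcases hc.eq_or_lt with rfl | hc
  · have : x = 0 := by
      funext S
      have h1 := congrFun hz S
      have h2 := nonneg_of_mem_supermodularCone hx S
      have h3 := mul_nonneg hβ.le (nonneg_of_mem_supermodularCone hy S)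
      simp only [Pi.add_apply, Pi.smul_apply, smul_eq_mul, zero_mul] at h1
      have h4 : α * x S ≤ α * 0 := by linarith
      exact le_antisymm (le_of_mul_le_mul_left h4 hα) h2
    rw [this]
    exact zero_mem_ray m
  let ox : Family N → ℝ := fun p => x (insert p.1.1 p.1.2) - x p.1.2
  let oy : Family N → ℝ := fun p => y (insert p.1.1 p.1.2) - y p.1.2
  have hox : IsDeterminedBy ox x := fun _ => rfl
  have hoy : IsDeterminedBy oy y := fun _ => rfl
  have hvx : IsValid (FVP N) ox (x univ) := isValid_FVP_iff.2 (dotProduct_famVec_le hx hox)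
  have hvy : IsValid (FVP N) oy (y univ) := isValid_FVP_iff.2 (dotProduct_famVec_le hy hoy)
  have ho_eq : α • ox + β • oy = c • o :=
    ((hox.smul α).add (hoy.smul β)).unique (hz ▸ hom.smul c)
  have hu_eq : α * x univ + β * y univ = c * u := by
    rw [← hu]
    exact congrFun hz univ
  -- A positive combination of two valid inequalities is tight only where both are.
  have htx : ∀ v ∈ tightSet (FVP N) o u, ox ⬝ᵥ v = x univ := by
    intro v hv
    have h1 := congrArg (· ⬝ᵥ v) ho_eq
    simp only [add_dotProduct, smul_dotProduct, smul_eq_mul, hv.2] at h1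
    have h2 := mul_le_mul_of_nonneg_left (hvy v hv.1) hβ.le
    have h3 : α * x univ ≤ α * (ox ⬝ᵥ v) := by linarith
    exact le_antisymm (hvx v hv.1) (le_of_mul_le_mul_left h3 hα)
  have hker : LinearMap.ker (dotLin o) ≤ LinearMap.ker (dotLin ox) :=
    hs ▸ vectorSpan_le_ker htx
  obtain ⟨t, ht'⟩ : ∃ t : ℝ, ox = t • o := by
    have h0 : (o ⬝ᵥ o) ≠ 0 := fun h => ho (dotProduct_self_eq_zero.1 h)
    refine ⟨(ox ⬝ᵥ o) / (o ⬝ᵥ o), ?_⟩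
    have h1 : ∀ v, ox ⬝ᵥ v = (ox ⬝ᵥ o) / (o ⬝ᵥ o) * (o ⬝ᵥ v) := by
      intro v
      have h2 : v - ((o ⬝ᵥ v) / (o ⬝ᵥ o)) • o ∈ LinearMap.ker (dotLin o) := by
        simp [dotProduct_sub, dotProduct_smul, h0]
      have h3 := hker h2
      simp only [LinearMap.mem_ker, dotLin_apply, dotProduct_sub, dotProduct_smul,
        smul_eq_mul] at h3
      rw [sub_eq_zero.1 h3]
      ring
    funext p
    have := h1 (Pi.single p 1)
    simpa using this
  have hxm : x = t • m := hx.1.ext_of_isDeterminedBy (hm.1.smul t) hox (ht' ▸ hom.smul t)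
  refine ⟨t, ?_, hxm⟩
  obtain ⟨S, hS⟩ := Function.ne_iff.1 hm0
  have h1 := nonneg_of_mem_supermodularCone hx S
  have h2 : 0 < m S := lt_of_le_of_ne (nonneg_of_mem_supermodularCone hm S) (Ne.symm hS)
  rw [hxm] at h1
  exact nonneg_of_mul_nonneg_left h1 h2

/-- The hyperplane of an inequality determined by an extreme function is spanned by its face. -/
theorem IsExtremeSupermodular.vectorSpan_eq_ker {N : Type*} [Fintype N] [DecidableEq N]
    {o : Family N → ℝ} {u : ℝ} {m : Finset N → ℝ} (hm : IsExtremeSupermodular m)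
    (hom : IsDeterminedBy o m) (hv : ∀ G : DAG N, o ⬝ᵥ famVec G ≤ u)
    (ht : ∀ H : DAG N, H.IsFull → o ⬝ᵥ famVec H = u) :
    vectorSpan ℝ (tightSet (FVP N) o u) = LinearMap.ker (dotLin o) := by
  refine (vectorSpan_le_ker fun v hv => hv.2).antisymm fun w hw => ?_
  by_contra hwn
  have hmem : ∀ G : DAG N, famVec G ∈ FVP N := fun G => subset_convexHull ℝ _ ⟨G, rfl⟩
  -- `f` vanishes on the directions of the face but not at `w`, so it is constant on the face
  -- without being a multiple of `o`.
  obtain ⟨f, hf, hle⟩ := Submodule.exists_le_ker_of_notMem hwn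
  obtain ⟨o', rfl⟩ := exists_dotLin_eq f
  obtain ⟨H, hH⟩ := DAG.exists_isFull N
  set u' := o' ⬝ᵥ famVec H with hu'
  have htight : ∀ G : DAG N, o ⬝ᵥ famVec G = u → o' ⬝ᵥ famVec G = u' := by
    intro G hG
    have h := hle (vsub_mem_vectorSpan ℝ (s := tightSet (FVP N) o u) ⟨hmem G, hG⟩
      ⟨hmem H, ht H hH⟩)
    simpa [dotProduct_sub, sub_eq_zero] using h
  obtain ⟨ε, hε, hp⟩ := exists_perturbation hv htight
  have hex : ∀ δ : ℝ, |δ| = ε → ∃ x ∈ supermodularCone N, IsDeterminedBy (o + δ • o') x := by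
    intro δ hδ
    refine exists_isDeterminedBy (u := u + δ * u') (fun G => ?_) (fun G hG => ?_)
    · have h1 := hp G
      rw [← hδ, ← abs_mul] at h1
      have h2 := (le_abs_self _).trans h1
      rw [add_dotProduct, smul_dotProduct, smul_eq_mul]
      linarith
    · rw [add_dotProduct, smul_dotProduct, smul_eq_mul, ht G hG, htight G (ht G hG)]
  obtain ⟨x, hx, hox⟩ := hex ε (abs_of_pos hε)
  obtain ⟨y, hy, hoy⟩ := hex (-ε) (by rw [abs_neg, abs_of_pos hε])
  -- The two perturbations average to `o`, so `m` is a midpoint in the cone; extremality makes `o +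
  -- ε • o'` a multiple of `o`, which fails at `w`.
  have hxy : (1 / 2 : ℝ) • x + (1 / 2 : ℝ) • y = m := by
    refine ((hx.1.smul _).add (hy.1.smul _)).ext_of_isDeterminedBy hm.1.1
      ((hox.smul _).add (hoy.smul _)) ?_
    convert hom using 1
    module
  obtain ⟨c, -, hc⟩ := hm.2.2.2 hx hy ⟨1, zero_le_one, by simp⟩
    ⟨1 / 2, 1 / 2, by norm_num, by norm_num, by norm_num, hxy⟩
  have h1 : o + ε • o' = c • o := hox.unique (hc ▸ hom.smul c)
  have h2 := congrArg (· ⬝ᵥ w) h1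
  have hw' : o ⬝ᵥ w = 0 := hw
  simp only [add_dotProduct, smul_dotProduct, smul_eq_mul, hw', mul_zero, zero_add] at h2
  exact hf ((mul_eq_zero.1 h2).resolve_left hε.ne')

end FamilyPolytope

open scoped Matrix in
theorem theorem2 {N : Type*} [Fintype N] [DecidableEq N] (hN : 2 ≤ Fintype.card N)
    (o : FamilyPolytope.Family N → ℝ) (u : ℝ) :
    (FamilyPolytope.IsFacetDefining (FamilyPolytope.FVP N) o u ∧
        ∀ H : FamilyPolytope.DAG N, H.IsFull → o ⬝ᵥ FamilyPolytope.famVec H = u) ↔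
      ∃ m : Finset N → ℝ, FamilyPolytope.IsExtremeSupermodular m ∧
        FamilyPolytope.IsDeterminedBy o m ∧
        ∀ H : FamilyPolytope.DAG N, H.IsFull → o ⬝ᵥ FamilyPolytope.famVec H = u := by
  open FamilyPolytope in
  obtain ⟨H, hH⟩ := DAG.exists_isFull N
  have hmem : famVec H ∈ FVP N := subset_convexHull ℝ _ ⟨H, rfl⟩
  constructor
  · rintro ⟨⟨hv, hd⟩, ht⟩
    have hne : (tightSet (FVP N) o u).Nonempty := ⟨famVec H, hmem, ht H hH⟩
    -- For `o = 0` the tight set would be the whole polytope, which has the wrong dimension.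
    have ho : o ≠ 0 := by
      rintro rfl
      have hu : u = 0 := by rw [← ht H hH, zero_dotProduct]
      have : tightSet (FVP N) 0 u = FVP N := by
        ext v
        simp [tightSet, hu]
      rw [this] at hd
      omega
    obtain ⟨m, hm, hom⟩ := exists_isDeterminedBy (isValid_FVP_iff.1 hv) ht
    exact ⟨m, isExtremeSupermodular_of_vectorSpan_eq_ker ho hm hom ht
      ((dim_tightSet_eq_iff ho hne).1 hd), hom, ht⟩
  · rintro ⟨m, hm, hom, ht⟩
    have hne : (tightSet (FVP N) o u).Nonempty := ⟨famVec H, hmem, ht H hH⟩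
    have ho : o ≠ 0 := by
      rintro rfl
      exact hm.2.1 (hm.1.1.ext_of_isDeterminedBy (fun _ _ => rfl) hom fun p => by simp)
    have hv : ∀ G : DAG N, o ⬝ᵥ famVec G ≤ u := fun G => by
      rw [← ht H hH, dotProduct_famVec_eq_of_isFull hm.1.1 hom hH]
      exact dotProduct_famVec_le hm.1 hom G
    exact ⟨⟨isValid_FVP_iff.2 hv,
      (dim_tightSet_eq_iff ho hne).2 (hm.vectorSpan_eq_ker hom hv ht)⟩, ht⟩
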